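/- A \emph{quasitopological group} is a group with a topology for which inversion is continuous and multiplication is continuous in each variable separately. For a space $A$ let $\pi_0^{top}(A)$ denote the set $\pi_0(A)$ of path components of $A$ with the quotient topology from $A$. For a based space $(A,a)$ let $\Omega(A,a)$ be the space of loops $[0,1]\to A$ at $a$ with the compact-open topology, and let $\pi_1^{top}(A,a)=\pi_0^{top}(\Omega(A,a))$, a group under concatenation of loops. Let $X$ be an arbitrary topological space, $X_+=X\sqcup\{*\}$, and let $\Sigma(X_+)=X_+\times[0,1]\,/\,(X\times\{0,1\}\cup\{*\}\times[0,1])$ be the reduced suspension with its quotient topology and canonical basepoint $x_0$; write $x\wedge t$ for the image of $(x,t)$ and $u_x$ for the loop $t\mapsto x\wedge t$. Let $M_T^*(X)=\coprod_{n\ge 0}(X\sqcup X^{-1})^n$ be the free topological monoid (with involution) on $X$, where $X^{-1}$ is a homeomorphic copy of $X$. Let $F_R^{P_X}(\pi_0^{top}(X))$ be the free group $F(\pi_0(X))$ on the set of path components of $X$ with the quotient topology with respect to the map $$\rho_X:\pi_0^{top}(M_T^*(X))\to F(\pi_0(X)),\qquad [x_1^{\epsilon_1}\cdots x_n^{\epsilon_n}]\mapsto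 [x_1]^{\epsilon_1}\cdots[x_n]^{\epsilon_n},$$ where $[x_i]$ is the path component of $x_i$ in $X$ and the product on the right is taken in the free group (reduction of words). Let $\varphi_X:F_R^{P_X}(\pi_0^{top}(X))\to\pi_1^{top}(\Sigma(X_+),x_0)$ be the group homomorphism determined by sending the path component of $x$ to the class of $u_x$. \textbf{Theorem.} For every topological space $X$: (1) $F_R^{P_X}(\pi_0^{top}(X))$ and $\pi_1^{top}(\Sigma(X_+),x_0)$ are quasitopological groups. (2) For every word $x_1^{\epsilon_1}\cdots x_n^{\epsilon_n}\in M_T^*(X)$, $\varphi_X(\rho_X([x_1^{\epsilon_1}\cdots x_n^{\epsilon_n}]))$ is the homotopy class of the $n$-fold concatenation $u_{x_1}^{\epsilon_1}*\cdots*u_{x_n}^{\epsilon_n}$ (the constant loop if $n=0$). (3) $\varphi_X$ is natural in $X$: for every continuous map $f:X\to Y$, $\varphi_Y\circ f_*=\Sigma(f_+)_*\circ\varphi_X$, where $f_*:F_R^{P_X}(\pi_0^{top}(X))\to F_R^{P_Y}(\pi_0^{top}(Y))$ is the homomorphism $[x]\mapsto[f(x)]$ and $\Sigma(f_+)(x\wedge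 t)=f(x)\wedge t$. (4) $\varphi_X$ is a homeomorphism. Hence $\varphi_X$ is a natural isomorphism of quasitopological groups. -/

import Mathlib

open scoped unitInterval

universe u v

noncomputable section

/-- A quasitopological group: a group with a topology for which inversion is continuous and
multiplication is continuous in each variable separately. -/
class IsQuasitopologicalGroup (G : Type u) [TopologicalSpace G] [Group G] : Prop
    extends ContinuousInv G, SeparatelyContinuousMul G

/-! ### Reduced suspensions -/

/-- The subset `Z × {0, 1} ∪ {z₀} × I` of `Z × I` which is collapsed in the reduced suspension. -/
def suspCollapsed {Z : Type u} (z₀ : Z) : Set (Z × I) :=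
  {p | p.2 = 0 ∨ p.2 = 1 ∨ p.1 = z₀}

/-- The equivalence relation on `Z × I` which identifies `Z × {0, 1} ∪ {z₀} × I` to a point. -/
def suspSetoid {Z : Type u} (z₀ : Z) : Setoid (Z × I) where
  r p q := p = q ∨ (p ∈ suspCollapsed z₀ ∧ q ∈ suspCollapsed z₀)
  iseqv :=
    { refl := fun _ => Or.inl rfl
      symm := by
        rintro p q (h | h)
        · exact Or.inl h.symm
        · exact Or.inr h.symm
      trans := by
        rintro p q r (rfl | h) (rfl | h')
        · exact Or.inl rfl
        · exact Or.inr h'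
        · exact Or.inr h
        · exact Or.inr ⟨h.1, h'.2⟩ }

/-- The reduced suspension `Σ Z = Z × I / (Z × {0, 1} ∪ {z₀} × I)` of a based space `(Z, z₀)`. -/
def ReducedSuspension (Z : Type u) (z₀ : Z) : Type u :=
  Quotient (suspSetoid z₀)

namespace ReducedSuspension

/-- The quotient topology, where `Z × I` has the product topology. -/
instance (Z : Type u) [TopologicalSpace Z] (z₀ : Z) :
    TopologicalSpace (ReducedSuspension Z z₀) :=
  inferInstanceAs (TopologicalSpace (Quotient (suspSetoid z₀)))

/-- The point `z ∧ t`. -/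
def mk {Z : Type u} (z₀ z : Z) (t : I) : ReducedSuspension Z z₀ :=
  Quotient.mk (suspSetoid z₀) (z, t)

/-- The canonical basepoint. -/
def base {Z : Type u} (z₀ : Z) : ReducedSuspension Z z₀ := mk z₀ z₀ 0

theorem mk_eq_base {Z : Type u} {z₀ z : Z} {t : I} (h : (z, t) ∈ suspCollapsed z₀) :
    mk z₀ z t = base z₀ :=
  Quotient.sound (Or.inr ⟨h, Or.inl rfl⟩)

theorem continuous_mk {Z : Type u} [TopologicalSpace Z] (z₀ : Z) :
    Continuous fun p : Z × I => mk z₀ p.1 p.2 :=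
  continuous_quotient_mk'

/-- The map `z ∧ t ↦ f z ∧ t` induced by a based map `f`. -/
def map {Z : Type u} {W : Type v} [TopologicalSpace Z] [TopologicalSpace W] {z₀ : Z} {w₀ : W}
    (f : C(Z, W)) (hf : f z₀ = w₀) : C(ReducedSuspension Z z₀, ReducedSuspension W w₀) where
  toFun := Quotient.lift (fun p : Z × I => mk w₀ (f p.1) p.2) (by
    rintro p q (rfl | ⟨hp, hq⟩)
    · rfl
    · have key : ∀ r ∈ suspCollapsed z₀, mk w₀ (f r.1) r.2 = base w₀ := by
        rintro r (h | h | h)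
        · exact mk_eq_base (Or.inl h)
        · exact mk_eq_base (Or.inr (Or.inl h))
        · exact mk_eq_base (Or.inr (Or.inr (by simp [h, hf])))
      exact (key p hp).trans (key q hq).symm)
  continuous_toFun := Continuous.quotient_lift
    ((continuous_mk w₀).comp ((f.continuous.comp continuous_fst).prodMk continuous_snd)) _

theorem map_base {Z : Type u} {W : Type v} [TopologicalSpace Z] [TopologicalSpace W] {z₀ : Z}
    {w₀ : W} (f : C(Z, W)) (hf : f z₀ = w₀) : map f hf (base z₀) = base w₀ :=
  mk_eq_base (Or.inl rfl)

end ReducedSuspension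

/-- The space `X₊ = X ⊔ {*}`, based at the disjoint point `*`. -/
abbrev AddDisjointPoint (X : Type u) : Type u := X ⊕ PUnit.{u + 1}

/-- The suspension `Σ(X₊)`. -/
abbrev SuspPlus (X : Type u) : Type u :=
  ReducedSuspension (AddDisjointPoint X) (Sum.inr PUnit.unit)

/-- The basepoint of `Σ(X₊)`. -/
abbrev SuspPlus.base (X : Type u) : SuspPlus X :=
  ReducedSuspension.base (Sum.inr PUnit.unit)

/-- The based map `Σ(f₊) : Σ(X₊) → Σ(Y₊)`, `x ∧ t ↦ f x ∧ t`. -/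
def SuspPlus.map {X : Type u} {Y : Type v} [TopologicalSpace X] [TopologicalSpace Y]
    (f : C(X, Y)) : C(SuspPlus X, SuspPlus Y) :=
  ReducedSuspension.map
    (⟨Sum.map f (fun _ => PUnit.unit), f.continuous.sumMap continuous_const⟩ :
      C(AddDisjointPoint X, AddDisjointPoint Y)) rfl

theorem SuspPlus.map_base {X : Type u} {Y : Type v} [TopologicalSpace X] [TopologicalSpace Y]
    (f : C(X, Y)) : SuspPlus.map f (SuspPlus.base X) = SuspPlus.base Y :=
  ReducedSuspension.map_base _ _

/-! ### Path component spaces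

The path component space of `X` is `ZerothHomotopy X` with its quotient topology. -/

/-- The continuous map induced on path component spaces. -/
def piZeroMap {X : Type u} {Y : Type v} [TopologicalSpace X] [TopologicalSpace Y] (f : C(X, Y)) :
    C(ZerothHomotopy X, ZerothHomotopy Y) where
  toFun := ZerothHomotopy.lift (fun x => ZerothHomotopy.mk (f x))
    (fun _ _ p => ZerothHomotopy.sound (p.map f.continuous))
  continuous_toFun := ZerothHomotopy.isQuotientMap_mk.continuous_iff.2
    (ZerothHomotopy.isQuotientMap_mk.continuous.comp f.continuous)

/-! ### The topological fundamental group -/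

/-- Path homotopic loops lie in the same path component of the loop space. -/
theorem joined_of_homotopic {A : Type u} [TopologicalSpace A] {a : A} {p q : Path a a}
    (h : p.Homotopic q) : Joined p q := by
  obtain ⟨F⟩ := h
  refine ⟨⟨⟨F.eval, ?_⟩, F.eval_zero, F.eval_one⟩⟩
  exact Path.continuous_uncurry_iff.1 F.continuous

/-- The topological fundamental group: the path component space of the loop space, where the
loop space `Path a a` has the compact-open topology. -/
def PiOneTop (A : Type u) [TopologicalSpace A] (a : A) : Type u := ZerothHomotopy (Path a a)

namespace PiOneTop

variable {A : Type u} [TopologicalSpace A] {a : A}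

instance : TopologicalSpace (PiOneTop A a) :=
  inferInstanceAs (TopologicalSpace (ZerothHomotopy (Path a a)))

/-- The class of a loop. -/
def mk (p : Path a a) : PiOneTop A a := ZerothHomotopy.mk p

theorem sound {p q : Path a a} (h : Joined p q) : mk p = mk q := Quotient.sound h

/-- The product of `[p]` and `[q]` is the class of the concatenation, first `p` and then `q`. -/
instance : Mul (PiOneTop A a) where
  mul := Quotient.map₂ (fun p q => p.trans q) (by
    rintro p p' ⟨F⟩ q q' ⟨G⟩
    exact ⟨⟨⟨fun t => (F t).trans (G t), F.continuous.path_trans G.continuous⟩,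
      by simp, by simp⟩⟩)

instance : One (PiOneTop A a) where
  one := mk (Path.refl a)

/-- The inverse of `[p]` is the class of the reversed loop. -/
instance : Inv (PiOneTop A a) where
  inv := Quotient.map (fun p => p.symm) (by
    rintro p p' ⟨F⟩
    exact ⟨⟨⟨fun t => (F t).symm, Path.continuous_symm.comp F.continuous⟩, by simp, by simp⟩⟩)

theorem mk_mul (p q : Path a a) : mk p * mk q = mk (p.trans q) := rfl

theorem mk_inv (p : Path a a) : (mk p)⁻¹ = mk p.symm := rfl

instance : Group (PiOneTop A a) :=
  Group.ofLeftAxioms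
    (by
      rintro ⟨p⟩ ⟨q⟩ ⟨r⟩
      exact sound (joined_of_homotopic ⟨Path.Homotopy.transAssoc p q r⟩))
    (by
      rintro ⟨p⟩
      exact sound (joined_of_homotopic ⟨Path.Homotopy.reflTrans p⟩))
    (by
      rintro ⟨p⟩
      exact sound (joined_of_homotopic ⟨(Path.Homotopy.reflSymmTrans p).symm⟩))

/-- The continuous homomorphism induced by a based map. -/
def map {B : Type v} [TopologicalSpace B] {b : B} (f : C(A, B)) (hf : f a = b) :
    PiOneTop A a →ₜ* PiOneTop B b where
  toFun := piZeroMap ⟨fun p : Path a a => (p.map f.continuous).cast hf.symm hf.symm, by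
    subst hf
    exact Path.continuous_uncurry_iff.1 (f.continuous.comp
      (continuous_eval : Continuous fun x : Path a a × I => x.1 x.2))⟩
  map_one' := by
    subst hf
    rfl
  map_mul' := by
    subst hf
    rintro ⟨p⟩ ⟨q⟩
    exact congrArg mk (Path.map_trans p q f.continuous)
  continuous_toFun := ContinuousMap.continuous _

end PiOneTop

/-! ### The free topological monoid with involution -/

/-- The free topological monoid `∐ₙ (Y ⊔ Y⁻¹)ⁿ` on `Y ⊔ Y⁻¹`, as a space: a coproduct of finite
powers of the disjoint union of two copies of `Y`. The letter `Sum.inl y` is `y` and the letter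
`Sum.inr y` is `y⁻¹`. -/
abbrev WordSpace (Y : Type u) : Type u := Σ n : ℕ, (Fin n → Y ⊕ Y)

namespace WordSpace

/-- The map `y₁^ε₁ ⋯ yₙ^εₙ ↦ f(y₁)^ε₁ ⋯ f(yₙ)^εₙ` induced by a function `f`. -/
def map {Y : Type u} {Z : Type v} (f : Y → Z) (w : WordSpace Y) : WordSpace Z :=
  ⟨w.1, fun i => Sum.map f f (w.2 i)⟩

theorem continuous_map {Y : Type u} {Z : Type v} [TopologicalSpace Y] [TopologicalSpace Z]
    {f : Y → Z} (hf : Continuous f) : Continuous (map f) := by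
  refine continuous_sigma fun n => ?_
  have h : Continuous fun (x : Fin n → Y ⊕ Y) (i : Fin n) => Sum.map f f (x i) :=
    continuous_pi fun i => (hf.sumMap hf).comp (continuous_apply i)
  exact continuous_sigmaMk.comp h

/-- The reduction homomorphism `R`, which evaluates a word in the free group on the set `Y`. -/
def reduce {Y : Type u} (w : WordSpace Y) : FreeGroup Y :=
  (List.ofFn fun i =>
    Sum.elim FreeGroup.of (fun y => (FreeGroup.of y)⁻¹) (w.2 i)).prod

theorem reduce_map {Y : Type u} {Z : Type v} (f : Y → Z) (w : WordSpace Y) :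
    reduce (map f w) = FreeGroup.map f (reduce w) := by
  unfold reduce
  rw [map_list_prod, List.map_ofFn]
  congr 2
  funext i
  simp only [map, Function.comp]
  cases w.2 i <;> simp

theorem sum_map_eq_of_joined {X : Type u} [TopologicalSpace X] {y z : X ⊕ X} (h : Joined y z) :
    Sum.map (ZerothHomotopy.mk (X := X)) (ZerothHomotopy.mk (X := X)) y
      = Sum.map ZerothHomotopy.mk ZerothHomotopy.mk z := by
  obtain ⟨p⟩ := h
  have h1 : ZerothHomotopy.mk (Sum.elim id id y) = ZerothHomotopy.mk (Sum.elim id id z) :=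
    ZerothHomotopy.sound (p.map (f := Sum.elim (id : X → X) id)
      (continuous_sumElim.2 ⟨continuous_id, continuous_id⟩))
  have hc : Continuous (Sum.isLeft : X ⊕ X → Bool) := by
    refine continuous_sum_dom.2 ⟨?_, ?_⟩
    · exact continuous_const (y := true)
    · exact continuous_const (y := false)
  have h2 : y.isLeft = z.isLeft := by
    have := PreconnectedSpace.constant (α := I) inferInstance (hc.comp p.continuous)
      (x := 0) (y := 1)
    simpa using this
  cases y <;> cases z <;> simp_all

/-- The canonical bijection `ψ` from the path component space of the word space on `X` to the word
space on the path component space of `X`, `[x₁^ε₁ ⋯ xₙ^εₙ] ↦ [x₁]^ε₁ ⋯ [xₙ]^εₙ`. -/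
def psi (X : Type u) [TopologicalSpace X] :
    ZerothHomotopy (WordSpace X) → WordSpace (ZerothHomotopy X) :=
  ZerothHomotopy.lift (map ZerothHomotopy.mk) (by
    intro v w p
    obtain ⟨n, g, hg, hpg⟩ := p.continuous.exists_lift_sigma
    have hv : v = ⟨n, g 0⟩ := by
      rw [← p.source]
      exact congrFun hpg 0
    have hw : w = ⟨n, g 1⟩ := by
      rw [← p.target]
      exact congrFun hpg 1
    subst hv hw
    refine congrArg (Sigma.mk n) (funext fun i => ?_)
    exact sum_map_eq_of_joined ⟨⟨⟨fun t => g t i, (continuous_apply i).comp hg⟩, rfl, rfl⟩⟩)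

end WordSpace

/-! ### The free group on the set of path components, with the quotient topology -/

/-- The free group on the set of path components of `X`, to carry the quotient topology of
reduction of words. -/
def FreeGroupRP (X : Type u) [TopologicalSpace X] : Type u := FreeGroup (ZerothHomotopy X)

namespace FreeGroupRP

instance (X : Type u) [TopologicalSpace X] : Group (FreeGroupRP X) :=
  inferInstanceAs (Group (FreeGroup (ZerothHomotopy X)))

/-- The composite `R ∘ ψ` from the path component space of the word space on `X` onto the free
group. -/
def proj (X : Type u) [TopologicalSpace X] (c : ZerothHomotopy (WordSpace X)) : FreeGroupRP X :=
  WordSpace.reduce (WordSpace.psi X c)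

/-- The quotient topology with respect to `R ∘ ψ`. -/
instance (X : Type u) [TopologicalSpace X] : TopologicalSpace (FreeGroupRP X) :=
  TopologicalSpace.coinduced (proj X) inferInstance

/-- The continuous homomorphism induced by a continuous map `f`, which sends the generator `[x]`
to the generator `[f x]`. -/
def map {X : Type u} {Y : Type v} [TopologicalSpace X] [TopologicalSpace Y] (f : C(X, Y)) :
    FreeGroupRP X →ₜ* FreeGroupRP Y where
  toMonoidHom := (FreeGroup.map (piZeroMap f) :
    FreeGroup (ZerothHomotopy X) →* FreeGroup (ZerothHomotopy Y))
  continuous_toFun := by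
    refine continuous_coinduced_dom.2 ?_
    have h : Continuous (proj Y ∘ piZeroMap ⟨WordSpace.map f,
        WordSpace.continuous_map f.continuous⟩) :=
      continuous_coinduced_rng.comp (ContinuousMap.continuous _)
    convert h using 1
    funext c
    obtain ⟨w, rfl⟩ := ZerothHomotopy.mk_surjective c
    refine (WordSpace.reduce_map (piZeroMap f) (WordSpace.map ZerothHomotopy.mk w)).symm.trans ?_
    refine congrArg WordSpace.reduce (congrArg (Sigma.mk w.1) (funext fun i => ?_))
    change Sum.map _ _ (Sum.map _ _ (w.2 i)) = Sum.map _ _ (Sum.map _ _ (w.2 i))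
    cases w.2 i <;> rfl

end FreeGroupRP

/-! ### The James map -/

/-- The James map `u : X → Ω(Σ(X₊))`, `u x t = x ∧ t`. -/
def jamesLoop {X : Type u} [TopologicalSpace X] (x : X) :
    Path (SuspPlus.base X) (SuspPlus.base X) where
  toFun t := ReducedSuspension.mk _ (Sum.inl x) t
  continuous_toFun := (ReducedSuspension.continuous_mk (Sum.inr PUnit.unit)).comp
    ((continuous_const (y := (Sum.inl x : AddDisjointPoint X))).prodMk continuous_id)
  source' := ReducedSuspension.mk_eq_base (Or.inl rfl)
  target' := ReducedSuspension.mk_eq_base (Or.inr (Or.inl rfl))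

theorem continuous_jamesLoop {X : Type u} [TopologicalSpace X] :
    Continuous (jamesLoop : X → Path (SuspPlus.base X) (SuspPlus.base X)) :=
  Path.continuous_uncurry_iff.1
    ((ReducedSuspension.continuous_mk (Sum.inr PUnit.unit : AddDisjointPoint X)).comp
      ((continuous_inl.comp continuous_fst).prodMk continuous_snd))

/-- The piecewise linear map of the interval which sends `[0, 1/(n+2)]` onto `[0, 1/2]` and
`[1/(n+2), 1]` onto `[1/2, 1]`. -/
def concatParam (n : ℕ) (t : I) : I :=
  Set.projIcc 0 1 zero_le_one
    (min ((n + 2 : ℝ) * t / 2) (1 / 2 + ((n + 2 : ℝ) * t - 1) / (2 * (n + 1))))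

theorem continuous_concatParam (n : ℕ) : Continuous (concatParam n) := by
  unfold concatParam
  fun_prop

theorem concatParam_zero (n : ℕ) : concatParam n 0 = 0 := by
  apply Set.projIcc_of_le_left
  simp

theorem concatParam_one (n : ℕ) : concatParam n 1 = 1 := by
  apply Set.projIcc_of_right_le
  have h : (n : ℝ) + 1 ≠ 0 := by positivity
  refine le_min ?_ ?_
  · simp only [Set.Icc.coe_one]
    have : (0 : ℝ) ≤ n := by positivity
    linarith
  · simp only [Set.Icc.coe_one]
    apply le_of_eq
    field_simp
    ring

/-- The `n`-fold concatenation of a list of `n` loops, whose restriction to `[(j-1)/n, j/n]` is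
the `j`-th loop; the concatenation of the empty list is the constant loop. -/
def concatLoops {A : Type u} [TopologicalSpace A] {a : A} : List (Path a a) → Path a a
  | [] => Path.refl a
  | [p] => p
  | p :: q :: l => (p.trans (concatLoops (q :: l))).reparam (concatParam l.length)
      (continuous_concatParam _) (concatParam_zero _) (concatParam_one _)

/-- The map from words to loops which sends the empty word to the constant loop and
`x₁^ε₁ ⋯ xₙ^εₙ` to the `n`-fold concatenation of the loops `(u x₁)^ε₁, …, (u xₙ)^εₙ`. -/
def jamesWord {X : Type u} [TopologicalSpace X] (w : WordSpace X) :
    Path (SuspPlus.base X) (SuspPlus.base X) :=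
  concatLoops (List.ofFn fun i => Sum.elim jamesLoop (fun x => (jamesLoop x).symm) (w.2 i))

/-- The group homomorphism `φ` from the free group on the path components of `X` to the topological
fundamental group of `Σ(X₊)`, determined by sending the path component of `x` to the class of the
loop `u x`. -/
def phi (X : Type u) [TopologicalSpace X] :
    FreeGroupRP X →* PiOneTop (SuspPlus X) (SuspPlus.base X) :=
  (FreeGroup.lift (piZeroMap ⟨jamesLoop, continuous_jamesLoop⟩) :
    FreeGroup (ZerothHomotopy X) →* PiOneTop (SuspPlus X) (SuspPlus.base X))

end

/-! Continuity of φ is checked on words, where it is concatenation of loops. For the inverse, cover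
Σ(X₊) by the points off height 1/2 and the points off the base point. Their intersection is a lower
and an upper half. Choose in each chart a path ("tail") from the base point to every point; the two
tails agree on the lower half and differ by the loop `u_x` on the upper half. Subdividing a loop
subordinately to the charts writes its class as a word with one letter per change of chart in the
upper half. The same subdivision serves all nearby loops, and the letters vary continuously with the
loop (`exists_word_mk_eq_phi`). This gives surjectivity and, given injectivity, continuity of the
inverse.

Injectivity is a monodromy argument: glue trivial bundles with fibre F(π₀X) over the two charts by 1
on the lower half and by right multiplication by [x] on the upper half, so that `u_x` has monodromy
[x]. The gluing is locally constant only if path components of X are open, so the base is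
retopologized as `FineSusp`, which leaves paths and homotopies continuous.

Finally, the quasitopological structure of the free group is pulled back along φ. -/

open Topology Filter

noncomputable section

/-! ### The group π₁ with its quotient topology. -/

namespace PiOneTop

variable {A : Type u} [TopologicalSpace A] {a : A}

theorem isQuotientMap_mk : IsQuotientMap (mk : Path a a → PiOneTop A a) :=
  ZerothHomotopy.isQuotientMap_mk

theorem mk_surjective : Function.Surjective (mk : Path a a → PiOneTop A a) :=
  isQuotientMap_mk.surjective

/-- By the exponential law for the compact-open topology, a path in the loop space is the same as a
homotopy of loops. -/
theorem mk_eq_mk_iff {p q : Path a a} : mk p = mk q ↔ p.Homotopic q := by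
  refine ⟨fun h => ?_, fun h => sound (joined_of_homotopic h)⟩
  obtain ⟨F⟩ : Joined p q := Quotient.exact h
  exact ⟨{ toFun := fun x => F x.1 x.2
           continuous_toFun := Path.continuous_uncurry_iff.2 F.continuous
           map_zero_left := by simp
           map_one_left := by simp
           prop' := by rintro t x (rfl | rfl) <;> simp }⟩

theorem one_eq : (1 : PiOneTop A a) = mk (Path.refl a) := rfl

theorem mk_trans_symm_mul {b : A} (p q r : Path a b) :
    mk (p.trans q.symm) * mk (q.trans r.symm) = mk (p.trans r.symm) := by
  rw [mk_mul, mk_eq_mk_iff]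
  have h1 : (q.symm.trans (q.trans r.symm)).Homotopic r.symm :=
    (Path.Homotopic.trans_assoc _ _ _).symm.trans
      ((Path.Homotopic.hcomp ⟨(Path.Homotopy.reflSymmTrans q).symm⟩ (.refl _)).trans
        ⟨Path.Homotopy.reflTrans _⟩)
  exact (Path.Homotopic.trans_assoc _ _ _).trans (Path.Homotopic.hcomp (.refl _) h1)

theorem mk_trans_symm_self {b : A} (p : Path a b) : mk (p.trans p.symm) = 1 :=
  mk_eq_mk_iff.2 ⟨(Path.Homotopy.reflTransSymm p).symm⟩

/-- Concatenation with a fixed loop and reversal are continuous on loops and descend along the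
quotient map. Joint continuity does not descend this way, since a product of quotient maps need not
be a quotient map. -/
instance isQuasitopologicalGroup : IsQuasitopologicalGroup (PiOneTop A a) where
  continuous_inv := isQuotientMap_mk.continuous_iff.2
    (isQuotientMap_mk.continuous.comp Path.continuous_symm)
  continuous_const_mul {x} := by
    obtain ⟨p, rfl⟩ := mk_surjective x
    exact isQuotientMap_mk.continuous_iff.2
      (isQuotientMap_mk.continuous.comp (continuous_const.path_trans continuous_id))
  continuous_mul_const {x} := by
    obtain ⟨p, rfl⟩ := mk_surjective x
    exact isQuotientMap_mk.continuous_iff.2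
      (isQuotientMap_mk.continuous.comp (continuous_id.path_trans continuous_const))

theorem mk_concatLoops (l : List (Path a a)) : mk (concatLoops l) = (l.map mk).prod := by
  induction l with
  | nil => rfl
  | cons p l ih =>
    cases l with
    | nil => simp [concatLoops]
    | cons q l =>
      rw [List.map_cons, List.prod_cons, ← ih, mk_mul]
      exact mk_eq_mk_iff.2 (Path.Homotopic.symm ⟨Path.Homotopy.reparam _ _ _ _ _⟩)

/-- The product of the classes of finitely many loops depends continuously on the loops. -/
theorem continuous_prod_ofFn_mk {Z : Type v} [TopologicalSpace Z] {n : ℕ}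
    {f : Z → Fin n → Path a a} (hf : Continuous f) :
    Continuous fun z => (List.ofFn fun i => mk (f z i)).prod := by
  -- Multiplication of classes need not be jointly continuous, so the loops are concatenated first
  -- and the class is taken once.
  obtain ⟨g, hg, hfg⟩ : ∃ g : Z → Path a a, Continuous g ∧
      ∀ z, (List.ofFn fun i => mk (f z i)).prod = mk (g z) := by
    induction n with
    | zero => exact ⟨fun _ => Path.refl a, continuous_const, fun z => by simp [one_eq]⟩
    | succ n ih =>
      obtain ⟨g, hg, hfg⟩ := ih (f := fun z i => f z i.succ) (by fun_prop)
      exact ⟨fun z => (f z 0).trans (g z), Continuous.path_trans (by fun_prop) hg, fun z => by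
        rw [List.ofFn_succ, List.prod_cons, hfg, mk_mul]⟩
  simp_rw [hfg]
  exact isQuotientMap_mk.continuous.comp hg

end PiOneTop

/-! ### The free group as a quotient of the word space. -/

namespace FreeGroupRP

variable {X : Type u} [TopologicalSpace X]

/-- The element of the free group represented by a word. -/
def ofWord (w : WordSpace X) : FreeGroupRP X := proj X (ZerothHomotopy.mk w)

theorem ofWord_eq (w : WordSpace X) :
    ofWord w = (WordSpace.map ZerothHomotopy.mk w).reduce := rfl

theorem ofWord_surjective : Function.Surjective (ofWord : WordSpace X → FreeGroupRP X) := by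
  intro g
  refine FreeGroup.induction_on (C := fun g => ∃ w, ofWord (X := X) w = g) g ?_ ?_ ?_ ?_
  · exact ⟨⟨0, Fin.elim0⟩, by simp [ofWord_eq, WordSpace.reduce, WordSpace.map]; rfl⟩
  · intro c
    obtain ⟨x, rfl⟩ := ZerothHomotopy.mk_surjective c
    exact ⟨⟨1, fun _ => Sum.inl x⟩, by simp [ofWord_eq, WordSpace.reduce, WordSpace.map]; rfl⟩
  · rintro c -
    obtain ⟨x, rfl⟩ := ZerothHomotopy.mk_surjective c
    exact ⟨⟨1, fun _ => Sum.inr x⟩, by simp [ofWord_eq, WordSpace.reduce, WordSpace.map]; rfl⟩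
  · rintro _ _ ⟨v, rfl⟩ ⟨w, rfl⟩
    refine ⟨⟨v.1 + w.1, Fin.append v.2 w.2⟩, ?_⟩
    simp only [ofWord_eq, WordSpace.reduce, WordSpace.map]
    rw [← List.prod_append, ← List.ofFn_fin_append]
    congr 2
    funext i
    refine Fin.addCases (fun j => ?_) (fun j => ?_) i <;> simp

theorem isQuotientMap_ofWord : IsQuotientMap (ofWord : WordSpace X → FreeGroupRP X) := by
  have h : IsQuotientMap (proj X) := ⟨⟨rfl⟩, Function.Surjective.of_comp
    (g := ZerothHomotopy.mk) ofWord_surjective⟩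
  exact h.comp ZerothHomotopy.isQuotientMap_mk

theorem ofWord_snoc {n : ℕ} (f : Fin n → X ⊕ X) (y : X ⊕ X) :
    ofWord ⟨n + 1, Fin.snoc f y⟩ = ofWord ⟨n, f⟩ * ofWord ⟨1, fun _ => y⟩ := by
  simp only [ofWord_eq, WordSpace.reduce, WordSpace.map]
  rw [List.ofFn_succ', List.concat_eq_append, List.prod_append]
  simp
  rfl

end FreeGroupRP

/-! ### The homomorphism φ: value on words, continuity, naturality. -/

section phi

variable {X : Type u} [TopologicalSpace X]

theorem phi_ofWord (w : WordSpace X) :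
    phi X (FreeGroupRP.ofWord w) = (List.ofFn fun i => PiOneTop.mk
      (Sum.elim jamesLoop (fun x => (jamesLoop x).symm) (w.2 i))).prod := by
  let F : Fin w.1 → FreeGroupRP X := fun i => Sum.elim FreeGroup.of (fun y => (FreeGroup.of y)⁻¹)
    (Sum.map (ZerothHomotopy.mk (X := X)) ZerothHomotopy.mk (w.2 i))
  have h : phi X (FreeGroupRP.ofWord w) = ((List.ofFn F).map (phi X)).prod :=
    map_list_prod (phi X) _
  rw [h, List.map_ofFn]
  congr 2
  funext i
  cases hi : w.2 i with
  | inl x => simp only [F, Function.comp, hi]; exact FreeGroup.lift_apply_of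
  | inr x =>
    simp only [F, Function.comp, hi]
    exact (map_inv (phi X) _).trans (congrArg (·⁻¹) FreeGroup.lift_apply_of)

theorem phi_ofWord_eq_jamesWord (w : WordSpace X) :
    phi X (FreeGroupRP.ofWord w) = PiOneTop.mk (jamesWord w) := by
  rw [phi_ofWord, jamesWord, PiOneTop.mk_concatLoops, List.map_ofFn]
  rfl

theorem continuous_phi : Continuous (phi X) := by
  refine FreeGroupRP.isQuotientMap_ofWord.continuous_iff.2 (continuous_sigma fun n => ?_)
  have h : Continuous (Sum.elim jamesLoop (fun x => (jamesLoop x).symm) :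
      X ⊕ X → Path (SuspPlus.base X) (SuspPlus.base X)) :=
    continuous_jamesLoop.sumElim (Path.continuous_symm.comp continuous_jamesLoop)
  refine (PiOneTop.continuous_prod_ofFn_mk (f := fun (w : Fin n → X ⊕ X) i =>
    Sum.elim jamesLoop (fun x => (jamesLoop x).symm) (w i)) (by fun_prop)).congr fun w => ?_
  exact (phi_ofWord ⟨n, w⟩).symm

theorem phi_of (x : X) :
    phi X (FreeGroup.of (ZerothHomotopy.mk x)) = PiOneTop.mk (jamesLoop x) :=
  FreeGroup.lift_apply_of

theorem phi_map {Y : Type v} [TopologicalSpace Y] (f : C(X, Y)) (g : FreeGroupRP X) :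
    phi Y (FreeGroupRP.map f g)
      = PiOneTop.map (SuspPlus.map f) (SuspPlus.map_base f) (phi X g) := by
  have h : (phi Y).comp (FreeGroupRP.map f).toMonoidHom =
      (PiOneTop.map (SuspPlus.map f) (SuspPlus.map_base f)).toMonoidHom.comp (phi X) := by
    refine FreeGroup.ext_hom _ _ fun c => ?_
    obtain ⟨x, rfl⟩ := ZerothHomotopy.mk_surjective c
    have h1 : FreeGroupRP.map f (FreeGroup.of (ZerothHomotopy.mk x)) =
      FreeGroup.of (ZerothHomotopy.mk (f x)) := FreeGroup.map.of
    refine (congrArg (phi Y) h1).trans ((phi_of (f x)).trans ?_)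
    exact (congrArg (PiOneTop.map (SuspPlus.map f) (SuspPlus.map_base f)) (phi_of x)).symm
  exact DFunLike.congr_fun h g

end phi

/-! ### The two charts of Σ(X₊). -/

instance unitInterval.contractibleSpace : ContractibleSpace I :=
  (convex_Icc (0 : ℝ) 1).contractibleSpace ⟨0, by simp⟩

namespace SuspPlus

variable {X : Type u}

/-- The point `x ∧ t` of `Σ(X₊)`. -/
def wedge (p : X × I) : SuspPlus X := ReducedSuspension.mk _ (Sum.inl p.1) p.2

@[simp] theorem wedge_zero (x : X) : wedge (x, 0) = base X :=
  ReducedSuspension.mk_eq_base (Or.inl rfl)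

@[simp] theorem wedge_one (x : X) : wedge (x, 1) = base X :=
  ReducedSuspension.mk_eq_base (Or.inr (Or.inl rfl))

theorem wedge_eq_base {p : X × I} (h : p.2 = 0 ∨ p.2 = 1) : wedge p = base X := by
  obtain ⟨x, s⟩ := p
  rcases h with rfl | rfl <;> simp

theorem wedge_eq_wedge_iff {p p' : X × I} :
    wedge p = wedge p' ↔ p = p' ∨ ((p.2 = 0 ∨ p.2 = 1) ∧ (p'.2 = 0 ∨ p'.2 = 1)) := by
  constructor
  · intro h
    rcases (Quotient.exact h : (suspSetoid _).r _ _) with h | ⟨h, h'⟩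
    · left
      simpa [Prod.ext_iff] using h
    · right
      simpa [suspCollapsed] using And.intro h h'
  · rintro (rfl | ⟨h, h'⟩)
    · rfl
    · rw [wedge_eq_base h, wedge_eq_base h']

theorem wedge_eq_base_iff {p : X × I} : wedge p = base X ↔ p.2 = 0 ∨ p.2 = 1 := by
  rw [← wedge_zero p.1, wedge_eq_wedge_iff]
  simp [Prod.ext_iff]

theorem wedge_surjective [Nonempty X] : Function.Surjective (wedge : X × I → SuspPlus X) := by
  rintro ⟨x | x, s⟩
  · exact ⟨(x, s), rfl⟩
  · exact ⟨(Classical.arbitrary X, 0),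
      (wedge_zero _).trans (ReducedSuspension.mk_eq_base (Or.inr (Or.inr rfl))).symm⟩

/-- The function on `Σ(X₊)` induced by a function on `X × I`. -/
def descend [Nonempty X] {T : Type*} (g : X × I → T) (y : SuspPlus X) : T :=
  g (Function.surjInv wedge_surjective y)

/-- Distinct preimages of one point both lie over the ends of `I`, where `g` has the common value
`c`. -/
theorem descend_wedge [Nonempty X] {T : Type*} {g : X × I → T} {c : T}
    (h0 : ∀ x, g (x, 0) = c) (h1 : ∀ x, g (x, 1) = c) (p : X × I) : descend g (wedge p) = g p := by
  have hg : ∀ p : X × I, p.2 = 0 ∨ p.2 = 1 → g p = c := by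
    rintro ⟨x, s⟩ (rfl | rfl)
    exacts [h0 x, h1 x]
  rcases wedge_eq_wedge_iff.1 (Function.surjInv_eq wedge_surjective (wedge p)) with h | ⟨h, h'⟩
  · exact congrArg g h
  · exact (hg _ h).trans (hg _ h').symm

/-- The coordinate in `X` of a point of `Σ(X₊)` away from the base point. -/
def coord [Nonempty X] : SuspPlus X → X :=
  -- The arbitrary value is taken only at the base point, which is outside the chart `false`.
  descend fun p => if p.2 = 0 ∨ p.2 = 1 then Classical.arbitrary X else p.1

/-- The height of a point of `Σ(X₊)`, with values in the circle `I / {0, 1}`, the base point having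
height `0`. -/
def height [Nonempty X] : SuspPlus X → I := descend fun p => if p.2 = 1 then 0 else p.2

theorem coord_wedge [Nonempty X] {p : X × I} (h0 : p.2 ≠ 0) (h1 : p.2 ≠ 1) :
    coord (wedge p) = p.1 := by
  rw [coord, descend_wedge (c := Classical.arbitrary X) (by simp) (by simp), if_neg (by tauto)]

theorem height_wedge [Nonempty X] (p : X × I) :
    height (wedge p) = if p.2 = 1 then 0 else p.2 := by
  rw [height, descend_wedge (c := 0) (by simp) (by simp)]

/-- The midpoint of the unit interval. -/
def mid : I := ⟨1 / 2, by norm_num, by norm_num⟩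

theorem zero_lt_mid : (0 : I) < mid := by
  rw [← Subtype.coe_lt_coe]; norm_num [mid]

theorem mid_lt_one : mid < (1 : I) := by
  rw [← Subtype.coe_lt_coe]; norm_num [mid]

/-- The two open sets covering `Σ(X₊)`: for `true`, the points of height different from `1/2`,
and for `false`, the points different from the base point. -/
def chart (X : Type u) [Nonempty X] (b : Bool) : Set (SuspPlus X) :=
  if b then {y | height y ≠ mid} else {y | y ≠ base X}

/-- The lower half of the intersection of the two charts. -/
def low (X : Type u) [Nonempty X] : Set (SuspPlus X) := {y | 0 < height y ∧ height y < mid}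

/-- The upper half of the intersection of the two charts. -/
def high (X : Type u) [Nonempty X] : Set (SuspPlus X) := {y | mid < height y}

section

variable [Nonempty X] (p : X × I)

theorem wedge_mem_chart_false : wedge p ∈ chart X false ↔ p.2 ≠ 0 ∧ p.2 ≠ 1 := by
  simp [chart, wedge_eq_base_iff]

theorem wedge_mem_chart_true : wedge p ∈ chart X true ↔ p.2 ≠ mid := by
  simp only [chart, if_true, Set.mem_ofPred_eq, height_wedge]
  split_ifs with h
  · simp [h, zero_lt_mid.ne, mid_lt_one.ne']
  · rfl

theorem wedge_mem_low : wedge p ∈ low X ↔ 0 < p.2 ∧ p.2 < mid := by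
  simp only [low, Set.mem_ofPred_eq, height_wedge]
  split_ifs with h
  · simp [h, mid_lt_one.le]
  · rfl

theorem wedge_mem_high : wedge p ∈ high X ↔ mid < p.2 ∧ p.2 < 1 := by
  simp only [high, Set.mem_ofPred_eq, height_wedge]
  split_ifs with h
  · simp [h]
  · simp [lt_iff_le_and_ne (b := (1 : I)), h, unitInterval.le_one']

theorem base_mem_chart_true : base X ∈ chart X true := by
  rw [← wedge_zero (Classical.arbitrary X), wedge_mem_chart_true]
  exact zero_lt_mid.ne

theorem base_notMem_chart_false : base X ∉ chart X false := by
  simp [chart]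

theorem low_union_high : low X ∪ high X = chart X false ∩ chart X true := by
  ext y
  obtain ⟨p, rfl⟩ := wedge_surjective y
  rw [Set.mem_union, Set.mem_inter_iff, wedge_mem_low, wedge_mem_high, wedge_mem_chart_true,
    wedge_mem_chart_false, ← unitInterval.pos_iff_ne_zero, ← unitInterval.lt_one_iff_ne_one]
  constructor
  · rintro (h | h)
    · exact ⟨⟨h.1, h.2.trans mid_lt_one⟩, h.2.ne⟩
    · exact ⟨⟨zero_lt_mid.trans h.1, h.2⟩, h.1.ne'⟩
  · rintro ⟨⟨h0, h1⟩, h2⟩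
    rcases lt_or_gt_of_ne h2 with h | h
    · exact Or.inl ⟨h0, h⟩
    · exact Or.inr ⟨h, h1⟩

theorem disjoint_low_high : Disjoint (low X) (high X) :=
  Set.disjoint_left.2 fun _ h h' => lt_asymm h.2 h'

theorem iUnion_chart : ⋃ b, chart X b = Set.univ := by
  refine Set.eq_univ_of_forall fun y => Set.mem_iUnion.2 ?_
  by_cases hy : y = base X
  · exact ⟨true, hy ▸ base_mem_chart_true⟩
  · exact ⟨false, by simpa [chart] using hy⟩

end

variable [TopologicalSpace X]

theorem continuous_wedge : Continuous (wedge : X × I → SuspPlus X) :=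
  (ReducedSuspension.continuous_mk _).comp
    ((continuous_inl.comp continuous_fst).prodMk continuous_snd)

/-- The summand `{*} × I` collapses to the base point, so the preimage of any set in it is
everything or empty, hence open. Thus `X × I` alone determines the topology. -/
theorem isQuotientMap_wedge [Nonempty X] : IsQuotientMap (wedge : X × I → SuspPlus X) := by
  refine ⟨isCoinducing_iff.2 fun U => ⟨fun h => ?_, fun h => h.preimage continuous_wedge⟩,
    wedge_surjective⟩
  refine (isQuotientMap_quotient_mk' (s := suspSetoid _)).isOpen_preimage.1 ?_
  refine ((Homeomorph.sumProdDistrib (X := X) (Y := PUnit.{u + 1}) (Z := I)).symm.isOpen_preimage).1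
    (isOpen_sum_iff.2 ⟨h, ?_⟩)
  have hz (z : PUnit.{u + 1} × I) :
      ReducedSuspension.mk (Sum.inr PUnit.unit) (Sum.inr z.1) z.2 = base X :=
    ReducedSuspension.mk_eq_base (Or.inr (Or.inr rfl))
  convert! isOpen_const (X := PUnit.{u + 1} × I) (p := base X ∈ U) using 1
  exact Set.ext fun z => iff_of_eq (congrArg (· ∈ U) (hz z))

section

variable [Nonempty X]

theorem isOpen_chart (b : Bool) : IsOpen (chart X b) := by
  rw [← isQuotientMap_wedge.isOpen_preimage]
  cases b
  · have h : wedge ⁻¹' chart X false = Prod.snd ⁻¹' {0, 1}ᶜ := by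
      ext p
      simp [wedge_mem_chart_false]
    rw [h]
    exact (Set.toFinite _).isClosed.isOpen_compl.preimage continuous_snd
  · have h : wedge ⁻¹' chart X true = Prod.snd ⁻¹' {mid}ᶜ := by
      ext p
      simp [wedge_mem_chart_true]
    rw [h]
    exact isClosed_singleton.isOpen_compl.preimage continuous_snd

theorem isOpen_low : IsOpen (low X) := by
  rw [← isQuotientMap_wedge.isOpen_preimage]
  have h : wedge ⁻¹' low X = Prod.snd ⁻¹' Set.Ioo 0 mid := by
    ext p
    simp [wedge_mem_low]
  rw [h]
  exact isOpen_Ioo.preimage continuous_snd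

theorem isOpen_high : IsOpen (high X) := by
  rw [← isQuotientMap_wedge.isOpen_preimage]
  have h : wedge ⁻¹' high X = Prod.snd ⁻¹' Set.Ioo mid 1 := by
    ext p
    simp [wedge_mem_high]
  rw [h]
  exact isOpen_Ioo.preimage continuous_snd

/-- Over an open set the quotient map is still a quotient map, and there the coordinate pulls back
to the first projection. This makes the letters of the words continuous. -/
theorem continuousOn_coord : ContinuousOn (coord : SuspPlus X → X) (chart X false) := by
  rw [isQuotientMap_wedge.continuousOn_isOpen_iff (isOpen_chart false)]
  refine continuous_fst.continuousOn.congr fun p hp => ?_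
  obtain ⟨h0, h1⟩ := (wedge_mem_chart_false p).1 hp
  exact coord_wedge h0 h1

end

/-! ### Tails from the base point to the points of a chart. -/

/-- The path `t ↦ x ∧ st` from the base point to `x ∧ s`, depending continuously on `x` and `s`. -/
def upward : C(X × I, C(I, SuspPlus X)) :=
  ContinuousMap.curry ⟨fun p => wedge (p.1.1, p.1.2 * p.2), continuous_wedge.comp (by fun_prop)⟩

/-- The path `t ↦ x ∧ (1 - (1 - s)t)` from the base point to `x ∧ s`, depending continuously on
`x` and `s`. -/
def downward : C(X × I, C(I, SuspPlus X)) :=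
  ContinuousMap.curry ⟨fun p => wedge (p.1.1, σ (σ p.1.2 * p.2)),
    continuous_wedge.comp (by fun_prop)⟩

theorem upward_apply (p : X × I) (t : I) : upward p t = wedge (p.1, p.2 * t) := rfl

theorem downward_apply (p : X × I) (t : I) : downward p t = wedge (p.1, σ (σ p.2 * t)) := rfl

theorem upward_zero (x : X) : upward (x, 0) = ContinuousMap.const I (base X) := by
  ext t
  simp [upward_apply]

theorem downward_one (x : X) : downward (x, 1) = ContinuousMap.const I (base X) := by
  ext t
  simp [downward_apply]

section

variable [Nonempty X]

/-- In each of the two charts, a choice of a path from the base point to every point of the chart: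
upwards in the chart `false`, and through the closest end of the interval in the chart `true`. -/
def tailMap : Bool → SuspPlus X → C(I, SuspPlus X)
  | true => descend fun p => if p.2 < mid then upward p else downward p
  -- The constant path at height 1 only makes the values at both ends agree; those points are
  -- outside the chart.
  | false => descend fun p => if p.2 = 1 then ContinuousMap.const I (base X) else upward p

theorem tailMap_true_wedge (p : X × I) :
    tailMap true (wedge p) = if p.2 < mid then upward p else downward p :=
  descend_wedge (g := fun p : X × I => if p.2 < mid then upward p else downward p)
    (c := ContinuousMap.const I (base X))
    (fun x => by simp only [if_pos zero_lt_mid, upward_zero])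
    (fun x => by simp only [if_neg mid_lt_one.not_gt, downward_one]) p

theorem tailMap_false_wedge (p : X × I) :
    tailMap false (wedge p) = if p.2 = 1 then ContinuousMap.const I (base X) else upward p :=
  descend_wedge
    (g := fun p : X × I => if p.2 = 1 then ContinuousMap.const I (base X) else upward p)
    (c := ContinuousMap.const I (base X))
    (fun x => by simp [upward_zero]) (fun x => by simp) p

/-- The jump between `upward` and `downward` occurs at height 1/2, which the chart `true` omits. -/
theorem continuousOn_tailMap (b : Bool) : ContinuousOn (tailMap b) (chart X b) := by
  rw [isQuotientMap_wedge.continuousOn_isOpen_iff (isOpen_chart b)]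
  cases b
  · refine upward.continuous.continuousOn.congr fun p hp => ?_
    rw [Function.comp_apply, tailMap_false_wedge, if_neg ((wedge_mem_chart_false p).1 hp).2]
  · refine continuousOn_of_forall_continuousAt fun p hp => ?_
    rcases lt_or_gt_of_ne ((wedge_mem_chart_true p).1 hp) with h | h
    · refine upward.continuous.continuousAt.congr ?_
      filter_upwards [(isOpen_Iio.preimage continuous_snd).mem_nhds h] with p' hp'
      rw [Function.comp_apply, tailMap_true_wedge, if_pos (Set.mem_Iio.1 hp')]
    · refine downward.continuous.continuousAt.congr ?_
      filter_upwards [(isOpen_Ioi.preimage continuous_snd).mem_nhds h] with p' hp'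
      rw [Function.comp_apply, tailMap_true_wedge, if_neg (not_lt_of_gt (Set.mem_Ioi.1 hp'))]

/-- The path from the base point to a point of a chart chosen by `tailMap`. -/
def tail (b : Bool) (y : SuspPlus X) : Path (base X) y where
  toContinuousMap := tailMap b y
  source' := by
    obtain ⟨p, rfl⟩ := wedge_surjective y
    cases b
    · simp only [tailMap_false_wedge]
      split_ifs <;> simp [upward_apply]
    · simp only [tailMap_true_wedge]
      split_ifs <;> simp [upward_apply, downward_apply]
  target' := by
    obtain ⟨p, rfl⟩ := wedge_surjective y
    cases b
    · simp only [tailMap_false_wedge]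
      split_ifs with h
      · exact (wedge_eq_base (Or.inr h)).symm
      · simp [upward_apply]
    · simp only [tailMap_true_wedge]
      split_ifs <;> simp [upward_apply, downward_apply]

theorem tail_apply (b : Bool) (y : SuspPlus X) (t : I) : tail b y t = tailMap b y t := rfl

theorem tail_true_base : tail true (base X) = Path.refl (base X) := by
  ext t
  rw [tail_apply, ← wedge_zero (Classical.arbitrary X), tailMap_true_wedge, if_pos zero_lt_mid,
    upward_zero]
  simp

theorem tail_false_eq_tail_true {y : SuspPlus X} (hy : y ∈ low X) : tail false y = tail true y := by
  ext t
  obtain ⟨p, rfl⟩ := wedge_surjective y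
  rw [wedge_mem_low] at hy
  rw [tail_apply, tail_apply, tailMap_false_wedge, tailMap_true_wedge, if_pos hy.2,
    if_neg (hy.2.trans mid_lt_one).ne]

/-- Both sides are images of paths from 0 to `s` in `{x} × I`: one direct, the other going up to 1
and back. They are homotopic because `I` is simply connected. -/
theorem tail_false_homotopic {y : SuspPlus X} (hy : y ∈ high X) :
    (tail false y).Homotopic ((jamesLoop (coord y)).trans (tail true y)) := by
  obtain ⟨⟨x, s⟩, rfl⟩ := wedge_surjective y
  obtain ⟨h, h1⟩ := (wedge_mem_high _).1 hy
  have hx : coord (wedge (x, s)) = x := coord_wedge (zero_lt_mid.trans h).ne' h1.ne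
  let P : Path (0 : I) s := ⟨⟨fun t => s * t, by fun_prop⟩, by simp, by simp⟩
  let Q : Path (0 : I) 1 := ⟨⟨fun t => t, by fun_prop⟩, by simp, by simp⟩
  let R : Path (1 : I) s := ⟨⟨fun t => σ (σ s * t), by fun_prop⟩, by simp, by simp⟩
  let f : C(I, SuspPlus X) := ⟨fun t => wedge (x, t), continuous_wedge.comp (by fun_prop)⟩
  have key := ((SimplyConnectedSpace.paths_homotopic P (Q.trans R)).map f).pathCast
    (wedge_zero x).symm rfl
  have hP : tail false (wedge (x, s)) = (P.map f.continuous).cast (wedge_zero x).symm rfl := by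
    ext t
    rw [tail_apply, tailMap_false_wedge, if_neg h1.ne]
    rfl
  have hQR : (jamesLoop x).trans (tail true (wedge (x, s))) =
      ((Q.trans R).map f.continuous).cast (wedge_zero x).symm rfl := by
    ext t
    simp only [Path.cast_coe, Path.map_coe, Function.comp_apply, Path.trans_apply]
    split_ifs
    · rfl
    · rw [tail_apply, tailMap_true_wedge, if_neg (not_lt_of_gt h)]
      rfl
  rw [hx, hP, hQR]
  exact key

theorem mk_tail_trans_tail_symm {y : SuspPlus X} (hy : y ∈ high X) :
    PiOneTop.mk ((tail false y).trans (tail true y).symm) = PiOneTop.mk (jamesLoop (coord y)) := by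
  rw [PiOneTop.mk_eq_mk_iff]
  refine (Path.Homotopic.hcomp (tail_false_homotopic hy) (.refl _)).trans ?_
  refine (Path.Homotopic.trans_assoc _ _ _).trans ?_
  refine (Path.Homotopic.hcomp (.refl _) ⟨(Path.Homotopy.reflTransSymm _).symm⟩).trans ?_
  exact ⟨Path.Homotopy.transRefl _⟩

/-! ### Classes of initial parts of a loop, closed up by tails. -/

/-- The initial part of a path up to time `t`. -/
def initialPart {A : Type*} [TopologicalSpace A] {a b : A} (q : Path a b) (t : I) :
    Path a (q t) where
  toFun s := q (t * s)
  source' := by simp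
  target' := by simp

/-- The class of the loop which follows `q` up to time `t` and then returns to the base point along
the path chosen in the chart `b`. -/
def partialClass (b : Bool) (q : Path (base X) (base X)) (t : I) :
    PiOneTop (SuspPlus X) (base X) :=
  PiOneTop.mk ((initialPart q t).trans (tail b (q t)).symm)

theorem partialClass_zero (q : Path (base X) (base X)) : partialClass true q 0 = 1 := by
  -- The endpoint is generalized because `q 0` equals the base point only propositionally.
  have h : ∀ {y : SuspPlus X} (γ : Path (base X) y), y = base X → (∀ s, γ s = base X) →
      PiOneTop.mk (γ.trans (tail true y).symm) = 1 := by
    rintro y γ rfl hγ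
    have hγ' : γ = tail true (base X) := by
      rw [tail_true_base]
      ext s
      simp [hγ]
    rw [hγ', PiOneTop.mk_trans_symm_self]
  exact h _ q.source fun s => by simp [initialPart]

theorem partialClass_one (q : Path (base X) (base X)) :
    partialClass true q 1 = PiOneTop.mk q := by
  have h : ∀ {y : SuspPlus X} (γ : Path (base X) y) (hy : y = base X),
      PiOneTop.mk (γ.trans (tail true y).symm) = PiOneTop.mk (γ.cast rfl hy.symm) := by
    rintro y γ rfl
    rw [tail_true_base, Path.refl_symm, PiOneTop.mk_eq_mk_iff]
    exact ⟨Path.Homotopy.transRefl _⟩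
  refine (h _ q.target).trans (congrArg PiOneTop.mk ?_)
  ext s
  simp [initialPart]

/-- While `q` stays in one chart, its tail varies continuously, so the closed-up loops form a path
in the loop space. -/
theorem partialClass_eq_of_mapsTo {b : Bool} {q : Path (base X) (base X)} {t t' : I} (htt : t ≤ t')
    (hq : Set.MapsTo q (Set.Icc t t') (chart X b)) : partialClass b q t = partialClass b q t' := by
  have hc : Continuous fun r : Set.Icc t t' =>
      (initialPart q r).trans (tail b (q r)).symm := by
    refine Path.continuous_uncurry_iff.1 (Path.trans_continuous_family _ ?_ _
      (Path.symm_continuous_family _ ?_))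
    · exact q.continuous.comp (by fun_prop)
    · have h1 : Continuous fun r : Set.Icc t t' => tailMap b (q r) :=
        (continuousOn_tailMap b).comp_continuous (q.continuous.comp continuous_subtype_val)
          fun r => hq r.2
      exact (h1.comp continuous_fst).eval continuous_snd
  have hconv : IsPathConnected (Set.Icc t t') := by
    have h2 : IsPathConnected (Set.Icc (t : ℝ) t') :=
      (convex_Icc _ _).isPathConnected ⟨t, le_rfl, htt⟩
    have h3 := h2.image (continuous_projIcc (a := (0 : ℝ)) (b := 1) (h := zero_le_one))
    convert h3
    ext r
    constructor
    · intro hr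
      exact ⟨r, ⟨hr.1, hr.2⟩, by simp⟩
    · rintro ⟨r, hr, rfl⟩
      rw [Set.projIcc_of_mem zero_le_one ⟨t.2.1.trans hr.1, hr.2.trans t'.2.2⟩]
      exact ⟨hr.1, hr.2⟩
  have := isPathConnected_iff_pathConnectedSpace.1 hconv
  exact PiOneTop.sound ((PathConnectedSpace.joined (⟨t, le_rfl, htt⟩ : Set.Icc t t')
    ⟨t', htt, le_rfl⟩).map hc)

theorem partialClass_eq_of_mem_low {q : Path (base X) (base X)} {t : I} (h : q t ∈ low X) :
    partialClass false q t = partialClass true q t := by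
  rw [partialClass, partialClass, tail_false_eq_tail_true h]

theorem partialClass_eq_of_mem_high {q : Path (base X) (base X)} {t : I} (h : q t ∈ high X) :
    partialClass true q t
      = partialClass false q t * PiOneTop.mk (jamesLoop (coord (q t))) := by
  rw [partialClass, partialClass, ← mk_tail_trans_tail_symm h, PiOneTop.mk_trans_symm_mul]

end

end SuspPlus

/-! ### Words depending continuously on a loop. -/

namespace SuspPlus

variable {X : Type u} [TopologicalSpace X]

theorem eventually_mapsTo_of_mapsTo {A : Type*} [TopologicalSpace A] {a b : A} (p : Path a b)
    {K : Set I} (hK : IsCompact K) {U : Set A} (hU : IsOpen U) (h : Set.MapsTo p K U) :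
    ∀ᶠ q : Path a b in 𝓝 p, Set.MapsTo q K U :=
  ((ContinuousMap.isOpen_setOfPred_mapsTo hK hU).preimage continuous_induced_dom).mem_nhds h

/-- Every loop near a given loop `p` is homotopic to the loop of a word which has a fixed length and
depends continuously on the loop at `p`. -/
theorem exists_word_mk_eq_phi [Nonempty X] (p : Path (base X) (base X)) :
    ∃ (n : ℕ) (f : Path (base X) (base X) → Fin n → X ⊕ X), ContinuousAt f p ∧
      ∀ᶠ q in 𝓝 p, PiOneTop.mk q = phi X (FreeGroupRP.ofWord ⟨n, f q⟩) := by
  -- The Lebesgue subdivision and its charts are fixed for `p`; each inclusion persists on a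
  -- compact-open neighbourhood of `p`.
  obtain ⟨t, ht0, htm, ⟨N, hN⟩, hcov⟩ := exists_monotone_Icc_subset_open_cover_unitInterval
    (c := fun b => p ⁻¹' chart X b) (fun b => (isOpen_chart b).preimage p.continuous) (by
      rw [← Set.preimage_iUnion, iUnion_chart, Set.preimage_univ])
  choose b hb using hcov
  -- At times 0 and 1 this forces the chart `true`, whose tail at the base point is constant.
  have hbase : ∀ k, p (t k) = base X → b k = true := fun k hk => by
    have h := hb k ⟨le_rfl, htm k.le_succ⟩
    rw [Set.mem_preimage, hk] at h
    cases hbk : b k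
    · exact absurd (hbk ▸ h) base_notMem_chart_false
    · rfl
  have key : ∀ k, ∃ (n : ℕ) (f : Path (base X) (base X) → Fin n → X ⊕ X), ContinuousAt f p ∧
      ∀ᶠ q in 𝓝 p, partialClass (b k) q (t k) = phi X (FreeGroupRP.ofWord ⟨n, f q⟩) := by
    intro k
    induction k with
    | zero =>
      refine ⟨0, fun _ => Fin.elim0, continuousAt_const, Eventually.of_forall fun q => ?_⟩
      rw [hbase 0 (by simp [ht0]), ht0, partialClass_zero, phi_ofWord]
      simp
    | succ k ih =>
      obtain ⟨n, f, hf, hfq⟩ := ih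
      have hmove : ∀ᶠ q in 𝓝 p,
          partialClass (b k) q (t (k + 1)) = phi X (FreeGroupRP.ofWord ⟨n, f q⟩) := by
        filter_upwards [hfq, eventually_mapsTo_of_mapsTo p isCompact_Icc (isOpen_chart (b k))
          (hb k)] with q h1 h2
        rw [← h1, partialClass_eq_of_mapsTo (htm k.le_succ) h2]
      by_cases hbb : b (k + 1) = b k
      · exact ⟨n, f, hf, hbb ▸ hmove⟩
      -- The division point lies in both adjacent pieces, hence in both charts when they differ.
      -- Changing chart in the lower half adds no letter.
      have hp : p (t (k + 1)) ∈ chart X false ∩ chart X true := by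
        have h1 := hb k ⟨htm k.le_succ, le_rfl⟩
        have h2 := hb (k + 1) ⟨le_rfl, htm (k + 1).le_succ⟩
        cases h3 : b k <;> cases h4 : b (k + 1) <;> simp_all
      have heval : Continuous fun q : Path (base X) (base X) => q (t (k + 1)) :=
        continuous_eval_const _
      rw [← low_union_high] at hp
      rcases hp with hp | hp
      · refine ⟨n, f, hf, ?_⟩
        filter_upwards [hmove, (isOpen_low.preimage heval).mem_nhds hp] with q h1 h2
        rw [← h1]
        have h3 := partialClass_eq_of_mem_low h2
        cases h4 : b k <;> cases h5 : b (k + 1) <;> simp_all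
      · have hcoord : ContinuousAt (fun q : Path (base X) (base X) => coord (q (t (k + 1)))) p :=
          ((continuousOn_coord).continuousAt ((isOpen_chart false).mem_nhds
            (low_union_high (X := X) ▸ Or.inr hp : _ ∈ chart X false ∩ chart X true).1)).comp
            (f := fun q : Path (base X) (base X) => q (t (k + 1))) heval.continuousAt
        -- In the upper half, passing from `false` to `true` appends the letter `x`, and from `true`
        -- to `false` its inverse.
        cases hbk : b k
        · have hbk' : b (k + 1) = true := by simpa [hbk] using hbb
          refine ⟨n + 1, fun q => Fin.snoc (f q) (Sum.inl (coord (q (t (k + 1))))),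
            hf.finSnoc (continuous_inl.continuousAt.comp hcoord), ?_⟩
          filter_upwards [hmove, (isOpen_high.preimage heval).mem_nhds hp] with q h1 h2
          rw [hbk] at h1
          rw [hbk', partialClass_eq_of_mem_high h2, h1, FreeGroupRP.ofWord_snoc, map_mul]
          congr 1
          simp [phi_ofWord]
        · have hbk' : b (k + 1) = false := by simpa [hbk] using hbb
          refine ⟨n + 1, fun q => Fin.snoc (f q) (Sum.inr (coord (q (t (k + 1))))),
            hf.finSnoc (continuous_inr.continuousAt.comp hcoord), ?_⟩
          filter_upwards [hmove, (isOpen_high.preimage heval).mem_nhds hp] with q h1 h2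
          rw [hbk] at h1
          rw [hbk', FreeGroupRP.ofWord_snoc, map_mul, ← h1, partialClass_eq_of_mem_high h2]
          simp [phi_ofWord, ← PiOneTop.mk_inv]
  obtain ⟨n, f, hf, hfq⟩ := key N
  refine ⟨n, f, hf, hfq.mono fun q hq => ?_⟩
  rw [← hq, hbase N (by simp [hN N le_rfl]), hN N le_rfl, partialClass_one]

end SuspPlus

theorem phi_surjective {X : Type u} [TopologicalSpace X] [Nonempty X] :
    Function.Surjective (phi X) := fun c => by
  obtain ⟨p, rfl⟩ := PiOneTop.mk_surjective c
  obtain ⟨n, f, -, hf⟩ := SuspPlus.exists_word_mk_eq_phi p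
  exact ⟨_, hf.self_of_nhds.symm⟩

/-- The inverse is tested on loops: near each `p` it is the word of the loop, evaluated in the free
group. -/
theorem isHomeomorph_phi_of_injective {X : Type u} [TopologicalSpace X] [Nonempty X]
    (h : Function.Injective (phi X)) : IsHomeomorph (phi X) := by
  let e := Equiv.ofBijective (phi X) ⟨h, phi_surjective⟩
  have hc : Continuous e.symm := by
    refine PiOneTop.isQuotientMap_mk.continuous_iff.2 (continuous_iff_continuousAt.2 fun p => ?_)
    obtain ⟨n, f, hf, hfq⟩ := SuspPlus.exists_word_mk_eq_phi p
    have h1 : ContinuousAt (fun q => FreeGroupRP.ofWord (⟨n, f q⟩ : WordSpace X)) p :=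
      (FreeGroupRP.isQuotientMap_ofWord.continuous.comp continuous_sigmaMk).continuousAt.comp hf
    refine h1.congr (hfq.mono fun q hq => ?_)
    rw [Function.comp_apply, hq]
    exact (e.symm_apply_apply _).symm
  exact Homeomorph.isHomeomorph
    { e with continuous_toFun := continuous_phi, continuous_invFun := hc }

/-! ### The covering space with fibre a discrete group. -/

instance unitInterval.locallyPathConnectedSpace : LocallyPathConnectedSpace I :=
  ChartedSpace.locallyPathConnectedSpace (EuclideanHalfSpace 1) I

/-- The set `Σ(X₊)`, to carry a coarser topology on its cells and a finer one on path components: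
the one generated by the two charts, the lower half of their intersection, and the parts of the
upper half which lie over a path component of `X`. -/
def FineSusp (X : Type u) : Type u := SuspPlus X

namespace FineSusp

open SuspPlus

variable {X : Type u} [TopologicalSpace X] [Nonempty X]

/-- The part of the upper half of the intersection of the charts over a path component of `X`. -/
def highOver (c : ZerothHomotopy X) : Set (FineSusp X) :=
  {y | y ∈ high X ∧ ZerothHomotopy.mk (coord y) = c}

/-- The two charts, as subsets of `FineSusp X`. -/
def fineChart (X : Type u) [Nonempty X] (b : Bool) : Set (FineSusp X) := chart X b

/-- The lower half of the intersection of the charts, as a subset of `FineSusp X`. -/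
def fineLow (X : Type u) [Nonempty X] : Set (FineSusp X) := low X

instance : TopologicalSpace (FineSusp X) :=
  TopologicalSpace.generateFrom (insert (fineLow X) (Set.range (fineChart X) ∪ Set.range highOver))

/-- A point of `Σ(X₊)` as a point of `FineSusp X`. -/
def of (y : SuspPlus X) : FineSusp X := y

theorem isOpen_fineChart (b : Bool) : IsOpen (fineChart X b) :=
  TopologicalSpace.isOpen_generateFrom_of_mem (Or.inr (Or.inl ⟨b, rfl⟩))

theorem isOpen_fineLow : IsOpen (fineLow X) :=
  TopologicalSpace.isOpen_generateFrom_of_mem (Or.inl rfl)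

theorem isOpen_highOver (c : ZerothHomotopy X) : IsOpen (highOver c) :=
  TopologicalSpace.isOpen_generateFrom_of_mem (Or.inr (Or.inr ⟨c, rfl⟩))

/-- A continuous map from a locally path-connected space to `Σ(X₊)` is continuous for the topology
of `FineSusp X`. -/
theorem continuous_of_comp {T : Type*} [TopologicalSpace T] [LocallyPathConnectedSpace T]
    {f : T → SuspPlus X} (hf : Continuous f) : Continuous fun t => of (f t) := by
  refine continuous_generateFrom_iff.2 ?_
  rintro U (rfl | ⟨b, rfl⟩ | ⟨c, rfl⟩)
  · exact SuspPlus.isOpen_low.preimage hf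
  · exact (SuspPlus.isOpen_chart b).preimage hf
  · refine isOpen_iff_mem_nhds.2 fun t ⟨ht, htc⟩ => ?_
    -- On a path-connected neighbourhood mapped into the upper half, paths push forward under
    -- `coord`, so the component of the coordinate is constant.
    obtain ⟨U, ⟨hU, hUc⟩, hUh⟩ := (path_connected_basis t).mem_iff.1
      ((isOpen_high.preimage hf).mem_nhds ht)
    refine mem_of_superset hU fun t' ht' => ⟨hUh ht', ?_⟩
    obtain ⟨γ, hγ⟩ := hUc.joinedIn t (mem_of_mem_nhds hU) t' ht'
    have hγc : Continuous fun r => coord (f (γ r)) :=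
      continuousOn_coord.comp_continuous (hf.comp γ.continuous) fun r =>
        (low_union_high (X := X) ▸ Or.inr (hUh (hγ r)) : _ ∈ chart X false ∩ chart X true).1
    refine Eq.trans ?_ htc
    exact (ZerothHomotopy.sound ⟨⟨fun r => coord (f (γ r)), hγc⟩, by simp [of], by simp [of]⟩).symm

variable {G : Type v} [Group G] (s : ZerothHomotopy X → G)

open Classical in
/-- The transition function between the two charts which is trivial on the lower half of their
intersection and is `s` on the upper half. -/
def shift (y : FineSusp X) : G :=
  if y ∈ high X then s (ZerothHomotopy.mk (coord y)) else 1

theorem shift_of_mem_low {y : FineSusp X} (hy : y ∈ fineLow X) : shift s y = 1 :=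
  if_neg (Set.disjoint_left.1 disjoint_low_high hy)

theorem shift_of_mem_highOver {y : FineSusp X} {c : ZerothHomotopy X} (hy : y ∈ highOver c) :
    shift s y = s c := by
  rw [shift, if_pos hy.1, hy.2]

/-- Right translations between the fibres over the two charts. -/
def coordChange : Bool → Bool → FineSusp X → G → G
  | false, true => fun y g => g * shift s y
  | true, false => fun y g => g * (shift s y)⁻¹
  | false, false => fun _ g => g
  | true, true => fun _ g => g

variable [TopologicalSpace G]

/-- The lower half and the sets `highOver c` are open by construction and `shift` is constant on
each. -/
theorem continuousOn_shift : ContinuousOn (shift s) (fineChart X false ∩ fineChart X true) := by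
  refine continuousOn_of_forall_continuousAt fun y hy => ?_
  rcases (low_union_high (X := X)).superset hy with hy | hy
  · exact (continuousAt_const (y := (1 : G))).congr
      ((isOpen_fineLow.eventually_mem hy).mono fun z hz => (shift_of_mem_low s hz).symm)
  · exact (continuousAt_const (y := s (ZerothHomotopy.mk (coord y)))).congr
      (((isOpen_highOver _).eventually_mem ⟨hy, rfl⟩).mono fun z hz =>
        (shift_of_mem_highOver s hz).symm)

variable [DiscreteTopology G]

open Classical in
/-- The principal bundle over `FineSusp X` with discrete fibre `G` and transition function
`shift s`. -/
def bundle : FiberBundleCore Bool (FineSusp X) G where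
  baseSet := fineChart X
  isOpen_baseSet := isOpen_fineChart
  -- Only points of height 1/2 are indexed by the chart `false`.
  indexAt y := if y ∈ fineChart X true then true else false
  mem_baseSet_at y := by
    split_ifs with h
    · exact h
    · obtain ⟨b, hb⟩ := Set.mem_iUnion.1 (iUnion_chart (X := X) ▸ Set.mem_univ y)
      cases b
      · exact hb
      · exact absurd hb h
  coordChange := coordChange s
  coordChange_self i y _ g := by cases i <;> rfl
  continuousOn_coordChange i j := by
    have h : ContinuousOn (fun p : FineSusp X × G => shift s p.1)
        ((fineChart X false ∩ fineChart X true) ×ˢ Set.univ) :=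
      (continuousOn_shift s).comp continuousOn_fst fun p hp => hp.1
    cases i <;> cases j
    · exact continuousOn_snd
    · exact continuousOn_snd.mul h
    · exact continuousOn_snd.mul (h.inv.mono (Set.prod_mono (Set.inter_comm _ _).subset le_rfl))
    · exact continuousOn_snd
  coordChange_comp i j k y _ g := by
    cases i <;> cases j <;> cases k <;> simp [coordChange]

theorem isCoveringMap_proj : IsCoveringMap (bundle s).proj := FiberBundle.isCoveringMap

/-- The point `g` of the fibre over the base point. -/
def fibrePoint (g : G) : (bundle s).TotalSpace := ⟨of (base X), g⟩

/-- A loop in `Σ(X₊)` lifts to a path from `g` to `h` in the covering space. -/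
def Lifts (p : Path (base X) (base X)) (g h : G) : Prop :=
  ∃ Γ : Path (fibrePoint s g) (fibrePoint s h), ∀ t, (Γ t).proj = of (p t)

variable {s}

theorem Lifts.refl (g : G) : Lifts s (Path.refl (base X)) g g := ⟨Path.refl _, fun _ => rfl⟩

theorem Lifts.symm {p : Path (base X) (base X)} {g h : G} (hp : Lifts s p g h) :
    Lifts s p.symm h g := by
  obtain ⟨Γ, hΓ⟩ := hp
  exact ⟨Γ.symm, fun t => hΓ _⟩

theorem Lifts.trans {p q : Path (base X) (base X)} {g h k : G} (hp : Lifts s p g h)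
    (hq : Lifts s q h k) : Lifts s (p.trans q) g k := by
  obtain ⟨Γ, hΓ⟩ := hp
  obtain ⟨Δ, hΔ⟩ := hq
  refine ⟨Γ.trans Δ, fun t => ?_⟩
  rw [Path.trans_apply, Path.trans_apply]
  split_ifs
  exacts [hΓ _, hΔ _]

/-- The homotopy remains continuous into `FineSusp X` because `I × I` is locally path-connected;
uniqueness and homotopy invariance of lifts for a covering map then apply. -/
theorem Lifts.eq_of_homotopic {p q : Path (base X) (base X)} {g h k : G} (hp : Lifts s p g h)
    (hq : Lifts s q g k) (hpq : p.Homotopic q) : h = k := by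
  obtain ⟨Γ, hΓ⟩ := hp
  obtain ⟨Δ, hΔ⟩ := hq
  obtain ⟨F⟩ := hpq
  let P : C(I, FineSusp X) := ⟨fun t => of (p t), continuous_of_comp p.continuous⟩
  let Q : C(I, FineSusp X) := ⟨fun t => of (q t), continuous_of_comp q.continuous⟩
  have hPQ : P.HomotopicRel Q {0, 1} :=
    ⟨{ toFun := fun x => of (F x)
       continuous_toFun := continuous_of_comp F.continuous
       map_zero_left := F.map_zero_left
       map_one_left := F.map_one_left
       prop' := F.prop' }⟩
  have hP : P 0 = (bundle s).proj (fibrePoint s g) := p.source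
  have hQ : Q 0 = (bundle s).proj (fibrePoint s g) := q.source
  have h1 := (isCoveringMap_proj s).liftPath_apply_one_eq_of_homotopicRel hPQ (fibrePoint s g) hP hQ
  have hΓ' := ((isCoveringMap_proj s).eq_liftPath_iff' (Γ := Γ.toContinuousMap) hP).2
    ⟨funext hΓ, Γ.source⟩
  have hΔ' := ((isCoveringMap_proj s).eq_liftPath_iff' (Γ := Δ.toContinuousMap) hQ).2
    ⟨funext hΔ, Δ.source⟩
  rw [← hΓ', ← hΔ'] at h1
  have h2 : fibrePoint s h = fibrePoint s k := Γ.target.symm.trans (h1.trans Δ.target)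
  exact eq_of_heq (Bundle.TotalSpace.mk.inj h2).2

/-- In the chart `false` the lift is constantly `g`; read in the chart `true` it is `g` below height
1/2 and `g * s [x]` above. -/
theorem lifts_jamesLoop (x : X) (g : G) :
    Lifts s (jamesLoop x) g (g * s (ZerothHomotopy.mk x)) := by
  let Z := bundle s
  -- This is the fibre coordinate in the chart given by `indexAt`, hence `g` at height 1/2, where
  -- that chart is `false`.
  let v : I → G := fun t => if t ≤ mid then g else g * s (ZerothHomotopy.mk x)
  let Γ : I → Z.TotalSpace := fun t => ⟨of (wedge (x, t)), v t⟩
  have hw : Continuous fun t : I => of (wedge (x, t)) :=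
    continuous_of_comp (continuous_wedge.comp (by fun_prop))
  have hindex_true : ∀ t, t ≠ mid → Z.indexAt (of (wedge (x, t))) = true := fun t ht =>
    if_pos ((wedge_mem_chart_true (x, t)).2 ht)
  have hindex_mid : Z.indexAt (of (wedge (x, mid))) = false :=
    if_neg fun h => (wedge_mem_chart_true (x, mid)).1 h rfl
  have hsymm : ∀ (i : Bool) (w : I → G) (t : I), ContinuousAt w t → wedge (x, t) ∈ chart X i →
      (∀ᶠ r in 𝓝 t, v r =
        coordChange s i (Z.indexAt (of (wedge (x, r)))) (of (wedge (x, r))) (w r)) →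
      ContinuousAt Γ t := by
    intro i w t hwt hti hv
    have h1 : ContinuousAt (Z.localTriv i).toOpenPartialHomeomorph.symm (of (wedge (x, t)), w t) :=
      (Z.localTriv i).continuousAt_symm ((Z.mem_localTriv_target i _).2 hti)
    refine (h1.comp (f := fun r : I => (of (wedge (x, r)), w r))
      (hw.continuousAt.prodMk hwt)).congr (hv.mono fun r hr => ?_)
    rw [Function.comp_apply]
    refine (Z.localTriv_symm_apply i _).trans ?_
    exact congrArg (Bundle.TotalSpace.mk (of (wedge (x, r)))) hr.symm
  have hΓ : Continuous Γ := by
    refine continuous_iff_continuousAt.2 fun t => ?_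
    rcases lt_trichotomy t mid with ht | rfl | ht
    · refine hsymm true (fun _ => g) t continuousAt_const
        ((wedge_mem_chart_true _).2 ht.ne) ?_
      filter_upwards [Iio_mem_nhds ht] with r hr
      rw [hindex_true r (ne_of_lt hr)]
      exact if_pos (le_of_lt hr)
    · refine hsymm false (fun _ => g) mid continuousAt_const
        ((wedge_mem_chart_false _).2 ⟨zero_lt_mid.ne', mid_lt_one.ne⟩) ?_
      filter_upwards [Ioo_mem_nhds zero_lt_mid mid_lt_one] with r hr
      rcases lt_trichotomy r mid with h | rfl | h
      · rw [hindex_true r h.ne]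
        simp only [coordChange]
        rw [shift_of_mem_low s (y := of (wedge (x, r))) ((wedge_mem_low _).2 ⟨hr.1, h⟩), mul_one]
        exact if_pos h.le
      · rw [hindex_mid]
        exact if_pos le_rfl
      · rw [hindex_true r h.ne']
        simp only [coordChange]
        rw [shift_of_mem_highOver s (y := of (wedge (x, r))) ⟨(wedge_mem_high _).2 ⟨h, hr.2⟩,
          congrArg ZerothHomotopy.mk (coord_wedge hr.1.ne' hr.2.ne)⟩]
        exact if_neg h.not_ge
    · refine hsymm true (fun _ => g * s (ZerothHomotopy.mk x)) t continuousAt_const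
        ((wedge_mem_chart_true _).2 ht.ne') ?_
      filter_upwards [Ioi_mem_nhds ht] with r hr
      rw [hindex_true r (ne_of_gt hr)]
      exact if_neg (not_le_of_gt hr)
  have hend : ∀ t, wedge (x, t) = base X → ∀ k, v t = k → Γ t = fibrePoint s k := by
    rintro t ht k rfl
    simp only [Γ, fibrePoint]
    rw [ht]
  exact ⟨⟨⟨Γ, hΓ⟩, hend 0 (wedge_zero x) _ (if_pos zero_lt_mid.le),
    hend 1 (wedge_one x) _ (if_neg mid_lt_one.not_ge)⟩, fun t => rfl⟩

/-- Monodromy is right multiplication, so it composes in the order of concatenation; the starting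
point `g` must be arbitrary for the induction. -/
theorem exists_lifts (a : FreeGroup (ZerothHomotopy X)) : ∃ p : Path (base X) (base X),
    PiOneTop.mk p = phi X a ∧ ∀ g, Lifts s p g (g * FreeGroup.lift s a) := by
  induction a using FreeGroup.induction_on with
  | C1 => exact ⟨Path.refl _, (map_one (phi X)).symm, fun g => by simpa using Lifts.refl g⟩
  | of c =>
    obtain ⟨x, rfl⟩ := ZerothHomotopy.mk_surjective c
    exact ⟨jamesLoop x, (phi_of x).symm, fun g => by simpa using lifts_jamesLoop x g⟩
  | inv_of c _ =>
    obtain ⟨x, rfl⟩ := ZerothHomotopy.mk_surjective c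
    refine ⟨(jamesLoop x).symm, ?_, fun g => ?_⟩
    · rw [← PiOneTop.mk_inv, ← phi_of]
      exact (map_inv (phi X) _).symm
    · simpa using (lifts_jamesLoop (s := s) x (g * (s (ZerothHomotopy.mk x))⁻¹)).symm
  | mul a b ha hb =>
    obtain ⟨p, hp, hp'⟩ := ha
    obtain ⟨q, hq, hq'⟩ := hb
    refine ⟨p.trans q, ?_, fun g => ?_⟩
    · rw [← PiOneTop.mk_mul, hp, hq]
      exact (map_mul (phi X) a b).symm
    · rw [map_mul, ← mul_assoc]
      exact (hp' g).trans (hq' _)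

theorem lift_eq_one_of_phi_eq_one {a : FreeGroup (ZerothHomotopy X)} (ha : phi X a = 1) :
    FreeGroup.lift s a = 1 := by
  obtain ⟨p, hp, hp'⟩ := exists_lifts (s := s) a
  rw [ha, PiOneTop.one_eq, PiOneTop.mk_eq_mk_iff] at hp
  simpa using (hp' 1).eq_of_homotopic (Lifts.refl 1) hp

end FineSusp

/-! ### Injectivity and conclusion. -/

theorem phi_injective {X : Type u} [TopologicalSpace X] [Nonempty X] :
    Function.Injective (phi X) := by
  refine (injective_iff_map_eq_one (phi X)).2 fun a ha => ?_
  let _ : TopologicalSpace (FreeGroup (ZerothHomotopy X)) := ⊥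
  have : DiscreteTopology (FreeGroup (ZerothHomotopy X)) := ⟨rfl⟩
  -- With the tautological `s`, the monodromy of `a` is `a` itself.
  have h := FineSusp.lift_eq_one_of_phi_eq_one (s := FreeGroup.of) ha
  rwa [FreeGroup.lift_of_eq_id] at h

theorem isHomeomorph_phi (X : Type u) [TopologicalSpace X] : IsHomeomorph (phi X) := by
  cases isEmpty_or_nonempty X
  -- For empty `X` the suspension is a point and both groups are trivial.
  · have h0 : IsEmpty (ZerothHomotopy X) := ⟨fun c =>
      isEmptyElim (ZerothHomotopy.mk_surjective c).choose⟩
    have h1 : Subsingleton (FreeGroupRP X) := inferInstanceAs (Subsingleton (FreeGroup _))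
    have h2 (y : SuspPlus X) : y = SuspPlus.base X := by
      obtain ⟨x | x, t⟩ := y
      · exact isEmptyElim x
      · exact ReducedSuspension.mk_eq_base (Or.inr (Or.inr rfl))
    have h3 : Subsingleton (PiOneTop (SuspPlus X) (SuspPlus.base X)) := ⟨by
      rintro ⟨p⟩ ⟨q⟩
      exact congrArg PiOneTop.mk (Path.ext (funext fun t => (h2 _).trans (h2 _).symm))⟩
    let e : FreeGroupRP X ≃ PiOneTop (SuspPlus X) (SuspPlus.base X) :=
      ⟨phi X, fun _ => 1, fun _ => Subsingleton.elim _ _, fun _ => Subsingleton.elim _ _⟩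
    exact Homeomorph.isHomeomorph
      { e with continuous_toFun := continuous_phi, continuous_invFun := continuous_const }
  · exact isHomeomorph_phi_of_injective phi_injective

/-- The homomorphism φ induces the topology of its source, so continuity of inversion and
translations is inherited from π₁. -/
instance FreeGroupRP.isQuasitopologicalGroup (X : Type u) [TopologicalSpace X] :
    IsQuasitopologicalGroup (FreeGroupRP X) where
  continuous_inv := (isHomeomorph_phi X).isInducing.continuous_iff.2 (by
    simpa only [Function.comp_def, map_inv] using continuous_inv.comp (continuous_phi (X := X)))
  continuous_const_mul {a} := (isHomeomorph_phi X).isInducing.continuous_iff.2 (by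
    simpa only [Function.comp_def, map_mul]
      using (continuous_const_mul (phi X a)).comp continuous_phi)
  continuous_mul_const {a} := (isHomeomorph_phi X).isInducing.continuous_iff.2 (by
    simpa only [Function.comp_def, map_mul]
      using (continuous_mul_const (phi X a)).comp continuous_phi)

end

theorem mainTheorem1 (X : Type u) [TopologicalSpace X] :
    IsQuasitopologicalGroup (FreeGroupRP X) ∧
    IsQuasitopologicalGroup (PiOneTop (SuspPlus X) (SuspPlus.base X)) ∧
    (∀ w : WordSpace X,
      phi X (FreeGroupRP.proj X (ZerothHomotopy.mk w)) = PiOneTop.mk (jamesWord w)) ∧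
    (∀ (Y : Type v) [TopologicalSpace Y] (f : C(X, Y)) (g : FreeGroupRP X),
      phi Y (FreeGroupRP.map f g)
        = PiOneTop.map (SuspPlus.map f) (SuspPlus.map_base f) (phi X g)) ∧
    IsHomeomorph (phi X) :=
  ⟨inferInstance, inferInstance, phi_ofWord_eq_jamesWord, fun _ _ f g => phi_map f g,
    isHomeomorph_phi X⟩
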